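/- There is a universal constant $K>0$ with the following property. Let $G=(V,E)$ be a finite connected graph without loops or parallel edges, with $n=|V|\geq 2$ vertices, and let $d_x$ be the degree of $x\in V$ and $d_{\min}=\min_{x\in V}d_x$. Let $P$ be the transition matrix of lazy random walk on $G$, that is, $P(x,x)=\frac12$, $P(x,y)=\frac{1}{2d_x}$ if $xy\in E$, and $P(x,y)=0$ otherwise. Its eigenvalues are real; list them with multiplicity as $1=\lambda_1>\lambda_2\geq\dots\geq\lambda_n\geq 0$, and let $t_{\mathrm{rel}}=(1-\lambda_2)^{-1}$ be the relaxation time. Place a unit resistance on each edge of $G$, and for $x,y\in V$ let $R_{\mathrm{eff}}(x\leftrightarrow y)$ be the effective resistance between $x$ and $y$, that is, $W(x)-W(y)$ for any voltage $W:V\to\mathbb{R}$ that drives a unit current from $x$ to $y$: $\sum_{v\,:\,uv\in E}(W(u)-W(v))=\mathbf 1_{\{u=x\}}-\mathbf 1_{\{u=y\}}$ for all $u\in V$. Then, for all $x,y\in V$, \[R_{\mathrm{eff}}(x\leftrightarrow y)\leq \frac{K\,\sqrt{t_{\mathrm{rel}}}}{d_{\min}}.\] -/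

import Mathlib

namespace LazyWalk

variable {V : Type*} [Fintype V] [DecidableEq V] (G : SimpleGraph V) [DecidableRel G.Adj]

/-- Transition matrix of lazy random walk on `G`. -/
noncomputable def transition : Matrix V V ℝ :=
  Matrix.of fun x y =>
    if y = x then 1 / 2 else if G.Adj x y then 1 / (2 * (G.degree x : ℝ)) else 0

/-- The eigenvalues of the lazy walk, repeated according to (algebraic) multiplicity and listed in
nonincreasing order, `λ₁ ≥ λ₂ ≥ …`. The transition matrix of a connected graph on `n ≥ 2` vertices
is similar to a symmetric one, so it has `n` real eigenvalues and the list has length `n`. -/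
noncomputable def eigenvalueList : List ℝ :=
  (transition G).charpoly.roots.sort (· ≥ ·)

/-- The second largest eigenvalue `λ₂`, counted with multiplicity: the entry at index `1` (indices
start at `0`). The default value `0` is used only if there are fewer than two eigenvalues, which
does not happen for connected graphs with at least two vertices. -/
noncomputable def secondEigenvalue : ℝ :=
  (eigenvalueList G).getD 1 0

/-- The relaxation time `t_rel = (1 - λ₂)⁻¹` of the lazy walk. -/
noncomputable def relaxationTime : ℝ :=
  (1 - secondEigenvalue G)⁻¹

/-- `W` is a voltage on the network `G` with unit resistances when a unit current enters at `x` and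
leaves at `y`: by Ohm's law the current along an edge from `u` to `v` is `W u - W v`, and by
Kirchhoff's node law the net current out of `u` is `1` at `x`, `-1` at `y`, and `0` elsewhere
(and `0` everywhere if `x = y`). -/
def IsUnitCurrentVoltage (x y : V) (W : V → ℝ) : Prop :=
  ∀ u : V, ∑ v ∈ G.neighborFinset u, (W u - W v) =
    (if u = x then 1 else 0) - (if u = y then 1 else 0)

variable {G}

theorem isUnitCurrentVoltage_iff {x y : V} {W : V → ℝ} :
    IsUnitCurrentVoltage G x y W ↔
      (G.lapMatrix ℝ).mulVec W = Pi.single x 1 - Pi.single y 1 := by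
  rw [funext_iff]
  refine forall_congr' fun u => ?_
  rw [SimpleGraph.lapMatrix_mulVec_apply]
  simp [Finset.sum_sub_distrib, Pi.single_apply]

/-- In a connected network a unit current voltage exists between any two vertices. -/
theorem exists_isUnitCurrentVoltage (hG : G.Connected) (x y : V) :
    ∃ W : V → ℝ, IsUnitCurrentVoltage G x y W := by
  classical
  let L : (V → ℝ) →ₗ[ℝ] (V → ℝ) := Matrix.toLin' (G.lapMatrix ℝ)
  let S : (V → ℝ) →ₗ[ℝ] ℝ := ∑ i, LinearMap.proj i
  have hS : ∀ f, S f = ∑ i, f i := fun f => by simp [S]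
  have hle : LinearMap.range L ≤ LinearMap.ker S := by
    rintro _ ⟨f, rfl⟩
    rw [LinearMap.mem_ker, hS]
    have h1 : ∑ i, L f i = (fun _ => (1 : ℝ)) ⬝ᵥ (G.lapMatrix ℝ).mulVec f := by
      simp [L, dotProduct]
    rw [h1, Matrix.dotProduct_mulVec, ← Matrix.mulVec_transpose, (G.isSymm_lapMatrix (R := ℝ)).eq,
      SimpleGraph.lapMatrix_mulVec_const_eq_zero, zero_dotProduct]
  have hkerL : Module.finrank ℝ (LinearMap.ker L) = 1 := by
    rw [← SimpleGraph.card_connectedComponent_eq_finrank_ker_toLin'_lapMatrix]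
    have := hG.preconnected.subsingleton_connectedComponent
    have : Nonempty G.ConnectedComponent := ⟨G.connectedComponentMk x⟩
    exact Fintype.card_eq_one_iff_nonempty_unique.2 ⟨⟨⟨Classical.arbitrary _⟩,
      fun _ => Subsingleton.elim _ _⟩⟩
  have hrangeS : Module.finrank ℝ (LinearMap.range S) = 1 := by
    have : LinearMap.range S = ⊤ := by
      rw [LinearMap.range_eq_top]
      intro c
      exact ⟨Pi.single x c, by simp [hS]⟩
    rw [this]
    simp
  have e1 := L.finrank_range_add_finrank_ker
  have e2 := S.finrank_range_add_finrank_ker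
  have heq := Submodule.eq_of_le_of_finrank_eq hle (by omega)
  have hmem : (Pi.single x 1 - Pi.single y 1 : V → ℝ) ∈ LinearMap.range L := by
    rw [heq, LinearMap.mem_ker, hS]
    simp
  obtain ⟨W, hW⟩ := hmem
  exact ⟨W, isUnitCurrentVoltage_iff.2 (by simpa [L] using hW)⟩

/-- Effective resistance between `x` and `y` with unit resistances on the edges: the voltage drop
from `x` to `y` that drives a unit current from `x` to `y`. -/
noncomputable def effectiveResistance (hG : G.Connected) (x y : V) : ℝ :=
  (exists_isUnitCurrentVoltage hG x y).choose x - (exists_isUnitCurrentVoltage hG x y).choose y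

/-- The effective resistance does not depend on the choice of the voltage. -/
theorem effectiveResistance_eq (hG : G.Connected) {x y : V} {W : V → ℝ}
    (hW : IsUnitCurrentVoltage G x y W) : effectiveResistance hG x y = W x - W y := by
  have h := (exists_isUnitCurrentVoltage hG x y).choose_spec
  rw [effectiveResistance]
  generalize (exists_isUnitCurrentVoltage hG x y).choose = U at h
  have h0 : (G.lapMatrix ℝ).mulVec (U - W) = 0 := by
    rw [Matrix.mulVec_sub, isUnitCurrentVoltage_iff.1 h, isUnitCurrentVoltage_iff.1 hW, sub_self]
  have := (SimpleGraph.lapMatrix_mulVec_eq_zero_iff_forall_reachable G).1 h0 x y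
    (hG.preconnected x y)
  simp only [Pi.sub_apply] at this
  linarith

end LazyWalk

/-!
Let `W` be the unit current voltage from `x` to `y`. At the level `m` midway between `W y` and
`W x`, one of the sets `{m < W}` and `{W < m}` carries at most half of the volume; by symmetry let
it be `{m < W}`. The truncation `(W - m)⁺` vanishes outside that set, and by Kirchhoff its Dirichlet
energy is at most `H = W x - m`, so the Poincaré inequality gives `∑ d (W - m)⁺² ≲ t_rel * H`.

Conversely, a current of total strength one changes the voltage by at most one along an edge, so the
superlevel set `{W ≥ W x - r}` contains the ball of radius `r` around `x`. As the neighbourhoods of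
vertices at distances `0, 3, 6, …` from `x` are disjoint, that ball has volume `≳ r * d_min ^ 2`.
For `2 / d_min ≤ r < 1` the bound persists because at most `1 / r` neighbours of `x` have voltage
below `W x - r`. With `r = H / 2` this yields `H ^ 3 * d_min ^ 2 ≲ t_rel * H`; if `r < 2 / d_min`,
then `H * d_min < 4` already, and `t_rel ≥ 1`.
-/


namespace LazyWalk

section Spectral

open LinearMap Module RCLike
open scoped InnerProductSpace

variable {𝕜 E : Type*} [RCLike 𝕜] [NormedAddCommGroup E] [InnerProductSpace 𝕜 E]
  {T : E →ₗ[𝕜] E}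

theorem inner_eq_zero_of_apply_eq_smul (hT : T.IsSymmetric) {μ ν : ℝ} (hμν : μ ≠ ν) {v w : E}
    (hv : T v = (μ : 𝕜) • v) (hw : T w = (ν : 𝕜) • w) : ⟪v, w⟫_𝕜 = 0 := by
  have h := hT v w
  rw [hv, hw, inner_smul_left, inner_smul_right, conj_ofReal] at h
  exact (mul_eq_mul_right_iff.1 h).resolve_left (ofReal_injective.ne hμν)

variable [FiniteDimensional 𝕜 E] {n : ℕ}

theorem re_inner_map_self_eq_sum (hT : T.IsSymmetric) (hn : finrank 𝕜 E = n) (v : E) :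
    re ⟪T v, v⟫_𝕜 =
      ∑ i, hT.eigenvalues hn i * ‖⟪hT.eigenvectorBasis hn i, v⟫_𝕜‖ ^ 2 := by
  rw [← (hT.eigenvectorBasis hn).sum_inner_mul_inner, map_sum]
  refine Finset.sum_congr rfl fun i _ => ?_
  rw [hT v, hT.apply_eigenvectorBasis, inner_smul_right, mul_assoc, re_ofReal_mul,
    inner_mul_symm_re_eq_norm, norm_mul, norm_inner_symm v, sq]

theorem eigenvalues_le_of_re_inner_map_self_le (hT : T.IsSymmetric) (hn : finrank 𝕜 E = n)
    {μ : ℝ} (hμ : ∀ v, re ⟪T v, v⟫_𝕜 ≤ μ * ‖v‖ ^ 2) (i : Fin n) :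
    hT.eigenvalues hn i ≤ μ := by
  simpa [hT.apply_eigenvectorBasis, inner_smul_left] using hμ (hT.eigenvectorBasis hn i)

theorem exists_second_eigenvector_orthogonal (hT : T.IsSymmetric) (hn : finrank 𝕜 E = n)
    (h1 : 1 < n) {e : E} {μ : ℝ} (he : T e = (μ : 𝕜) • e)
    (hμ : ∀ v, re ⟪T v, v⟫_𝕜 ≤ μ * ‖v‖ ^ 2) :
    ∃ g ≠ 0, ⟪e, g⟫_𝕜 = 0 ∧ T g = (hT.eigenvalues hn ⟨1, h1⟩ : 𝕜) • g := by
  set b := hT.eigenvectorBasis hn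
  set i₀ : Fin n := ⟨0, by omega⟩
  set i₁ : Fin n := ⟨1, h1⟩
  by_cases horth : ⟪e, b i₁⟫_𝕜 = 0
  · exact ⟨b i₁, b.orthonormal.ne_zero i₁, horth, hT.apply_eigenvectorBasis hn i₁⟩
  -- `μ` is now at least a double eigenvalue, so `b i₀` can be corrected by a multiple of `b i₁`.
  have hμ₁ : hT.eigenvalues hn i₁ = μ := by
    by_contra hne
    exact horth (inner_eq_zero_of_apply_eq_smul hT (Ne.symm hne) he
      (hT.apply_eigenvectorBasis hn i₁))
  have hμ₀ : hT.eigenvalues hn i₀ = μ :=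
    (eigenvalues_le_of_re_inner_map_self_le hT hn hμ i₀).antisymm
      (hμ₁ ▸ hT.eigenvalues_antitone hn (Fin.mk_le_mk.2 zero_le_one))
  refine ⟨b i₀ - (⟪e, b i₀⟫_𝕜 / ⟪e, b i₁⟫_𝕜) • b i₁, fun h => ?_, ?_, ?_⟩
  · have hinner := congrArg (fun v => ⟪b i₀, v⟫_𝕜) h
    simp [inner_sub_right, inner_smul_right, orthonormal_iff_ite.1 b.orthonormal, i₀, i₁] at hinner
  · rw [inner_sub_right, inner_smul_right, div_mul_cancel₀ _ horth, sub_self]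
  · rw [map_sub, map_smul, hT.apply_eigenvectorBasis, hT.apply_eigenvectorBasis, hμ₀, hμ₁, smul_sub,
      smul_comm]

theorem re_inner_map_self_le_second_eigenvalue (hT : T.IsSymmetric) (hn : finrank 𝕜 E = n)
    (h1 : 1 < n) {e : E} (he₀ : e ≠ 0) {μ : ℝ} (he : T e = (μ : 𝕜) • e)
    (hμ : ∀ v, re ⟪T v, v⟫_𝕜 ≤ μ * ‖v‖ ^ 2) {g : E} (hg : ⟪e, g⟫_𝕜 = 0) :
    re ⟪T g, g⟫_𝕜 ≤ hT.eigenvalues hn ⟨1, h1⟩ * ‖g‖ ^ 2 := by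
  set b := hT.eigenvectorBasis hn
  set i₀ : Fin n := ⟨0, by omega⟩
  set i₁ : Fin n := ⟨1, h1⟩
  rcases (eigenvalues_le_of_re_inner_map_self_le hT hn hμ i₁).eq_or_lt with hμ₁ | hμ₁
  · exact hμ₁ ▸ hμ g
  have hle : ∀ i ≠ i₀, hT.eigenvalues hn i ≤ hT.eigenvalues hn i₁ := fun i hi =>
    hT.eigenvalues_antitone hn (Nat.one_le_iff_ne_zero.2 fun h => hi (Fin.ext h))
  have horth : ∀ i ≠ i₀, ⟪e, b i⟫_𝕜 = 0 := fun i hi =>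
    inner_eq_zero_of_apply_eq_smul hT ((hle i hi).trans_lt hμ₁).ne' he
      (hT.apply_eigenvectorBasis hn i)
  have hsingle : ∀ v, ⟪e, v⟫_𝕜 = ⟪e, b i₀⟫_𝕜 * ⟪b i₀, v⟫_𝕜 := fun v => by
    rw [← b.sum_inner_mul_inner e v]
    exact Fintype.sum_eq_single i₀ fun i hi => by rw [horth i hi, zero_mul]
  have hb₀ : ⟪b i₀, g⟫_𝕜 = 0 := by
    refine (mul_eq_zero.1 ((hsingle g).symm.trans hg)).resolve_left fun h => he₀ ?_
    rw [← inner_self_eq_zero (𝕜 := 𝕜), hsingle, h, zero_mul]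
  rw [re_inner_map_self_eq_sum hT hn, ← b.sum_sq_norm_inner_right, Finset.mul_sum]
  refine Finset.sum_le_sum fun i _ => ?_
  rcases eq_or_ne i i₀ with rfl | hi
  · simp [b, hb₀]
  · gcongr
    exact hle i hi

end Spectral

section DirichletForm

open Matrix

variable {V : Type*} [Fintype V] {G : SimpleGraph V} [DecidableRel G.Adj]

theorem sum_degree_mul_eq_sum_adj (f : V → ℝ) :
    ∑ u, G.degree u * f u = ∑ u, ∑ v, if G.Adj u v then f u else 0 := by
  simp only [G.degree_eq_sum_if_adj, Finset.sum_mul, ite_mul, one_mul, zero_mul]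

variable [DecidableEq V]

variable (G) in
/-- The Dirichlet form of the network with unit resistances: the sum of
`(f u - f v) * (g u - g v)` over the edges `uv`, each edge being counted once. -/
def dirichletForm (f g : V → ℝ) : ℝ :=
  f ⬝ᵥ G.lapMatrix ℝ *ᵥ g

theorem lapMatrix_mulVec_apply_eq_sum (f : V → ℝ) (u : V) :
    (G.lapMatrix ℝ *ᵥ f) u = ∑ v, if G.Adj u v then f u - f v else 0 := by
  rw [G.lapMatrix_mulVec_apply, G.degree_eq_sum_if_adj, G.neighborFinset_eq_filter,
    Finset.sum_filter, Finset.sum_mul, ← Finset.sum_sub_distrib]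
  exact Finset.sum_congr rfl fun v _ => by split_ifs <;> simp

theorem dirichletForm_eq_sum (f g : V → ℝ) :
    dirichletForm G f g =
      (∑ u, ∑ v, if G.Adj u v then (f u - f v) * (g u - g v) else 0) / 2 := by
  have hleft : dirichletForm G f g = ∑ u, ∑ v, if G.Adj u v then f u * (g u - g v) else 0 := by
    simp only [dirichletForm, dotProduct, lapMatrix_mulVec_apply_eq_sum, Finset.mul_sum, mul_ite,
      mul_zero]
  have hright : dirichletForm G f g = ∑ u, ∑ v, if G.Adj u v then f v * (g v - g u) else 0 := by
    rw [hleft, Finset.sum_comm]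
    simp only [G.adj_comm]
  rw [eq_div_iff two_ne_zero, mul_two]
  nth_rewrite 1 [hleft]
  simp only [hright, ← Finset.sum_add_distrib]
  refine Finset.sum_congr rfl fun u _ => Finset.sum_congr rfl fun v _ => ?_
  split_ifs <;> ring

theorem dirichletForm_comm (f g : V → ℝ) : dirichletForm G f g = dirichletForm G g f := by
  simp only [dirichletForm_eq_sum, mul_comm]

theorem dirichletForm_sub_const_right (f g : V → ℝ) (c : ℝ) :
    dirichletForm G f (fun u => g u - c) = dirichletForm G f g := by
  simp only [dirichletForm_eq_sum, sub_sub_sub_cancel_right]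

theorem dirichletForm_sub_const_self (f : V → ℝ) (c : ℝ) :
    dirichletForm G (fun u => f u - c) (fun u => f u - c) = dirichletForm G f f := by
  simp only [dirichletForm_eq_sum, sub_sub_sub_cancel_right]

theorem dirichletForm_self_nonneg (f : V → ℝ) : 0 ≤ dirichletForm G f f :=
  (G.posSemidef_lapMatrix ℝ).dotProduct_mulVec_nonneg f

theorem eq_of_dirichletForm_self_eq_zero (hG : G.Connected) {f : V → ℝ}
    (h : dirichletForm G f f = 0) (u v : V) : f u = f v :=
  (G.lapMatrix_toLinearMap₂'_apply'_eq_zero_iff_forall_reachable f).1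
    ((toLinearMap₂'_apply' ..).trans h) u v (hG.preconnected u v)

theorem dirichletForm_self_le (f : V → ℝ) :
    dirichletForm G f f ≤ 2 * ∑ u, G.degree u * f u ^ 2 := by
  have hswap : ∑ u, G.degree u * f u ^ 2 = ∑ u, ∑ v, if G.Adj u v then f v ^ 2 else 0 := by
    rw [sum_degree_mul_eq_sum_adj, Finset.sum_comm]
    simp only [G.adj_comm]
  have hsum : 2 * ∑ u, G.degree u * f u ^ 2 =
      (∑ u, ∑ v, if G.Adj u v then 2 * (f u ^ 2 + f v ^ 2) else 0) / 2 := by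
    rw [eq_div_iff two_ne_zero, mul_assoc, mul_two]
    nth_rewrite 1 [sum_degree_mul_eq_sum_adj]
    simp only [hswap, ← Finset.sum_add_distrib, Finset.mul_sum]
    refine Finset.sum_congr rfl fun u _ => Finset.sum_congr rfl fun v _ => ?_
    split_ifs <;> ring
  rw [dirichletForm_eq_sum, hsum]
  gcongr with u _ v _
  split_ifs
  · linarith [sq_nonneg (f u + f v)]
  · rfl

theorem dirichletForm_posPart_self_le (f : V → ℝ) :
    dirichletForm G f⁺ f⁺ ≤ dirichletForm G f⁺ f := by
  have hpos : ∀ a b : ℝ, (a⁺ - b⁺) * (a⁺ - b⁺) ≤ (a⁺ - b⁺) * (a - b) := fun a b => by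
    rcases le_total a 0 with ha | ha <;> rcases le_total b 0 with hb | hb <;>
      simp only [posPart_of_nonpos, posPart_of_nonneg, ha, hb] <;> nlinarith
  simp only [dirichletForm_eq_sum, Pi.posPart_apply]
  gcongr
  split_ifs
  · exact hpos _ _
  · rfl

theorem mul_sub_le_dirichletForm {f g : V → ℝ} (hfg : Monovary f g) {u v : V}
    (huv : G.Adj u v) : (f u - f v) * (g u - g v) ≤ dirichletForm G f g := by
  set F : V × V → ℝ := fun p =>
    if G.Adj p.1 p.2 then (f p.1 - f p.2) * (g p.1 - g p.2) else 0
  have hF : ∀ p, 0 ≤ F p := fun p => by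
    simp only [F]
    split_ifs
    exacts [monovary_iff_forall_mul_nonneg.1 hfg _ _, le_rfl]
  have hpair : ∑ p ∈ {(u, v), (v, u)}, F p ≤ ∑ p, F p :=
    Finset.sum_le_univ_sum_of_nonneg hF
  rw [Finset.sum_pair (by simp [huv.ne]), Fintype.sum_prod_type] at hpair
  simp only [F, huv, huv.symm, if_true] at hpair
  rw [dirichletForm_eq_sum]
  linarith

end DirichletForm

section LazyWalkSpectrum

open Matrix Module
open scoped InnerProductSpace

variable {V : Type*} [Fintype V] {G : SimpleGraph V} [DecidableRel G.Adj]

theorem degree_pos_of_connected [Nontrivial V] (hG : G.Connected) (u : V) :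
    (0 : ℝ) < G.degree u :=
  Nat.cast_pos.2 (hG.preconnected.degree_pos_of_nontrivial u)

theorem sqrt_degree_ne_zero [Nontrivial V] (hG : G.Connected) (u : V) :
    √(G.degree u : ℝ) ≠ 0 :=
  (Real.sqrt_pos.2 (degree_pos_of_connected hG u)).ne'

/-- The isometry `f ↦ √d · f` from the functions on `V`, with the inner product weighted by the
degrees, onto Euclidean space. -/
noncomputable def degreeScaling [Nontrivial V] (hG : G.Connected) :
    (V → ℝ) ≃ₗ[ℝ] EuclideanSpace ℝ V :=
  (LinearEquiv.piCongrRight fun u =>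
    LinearEquiv.smulOfNeZero ℝ ℝ (√(G.degree u : ℝ)) (sqrt_degree_ne_zero hG u)) ≪≫ₗ
  (WithLp.linearEquiv 2 ℝ (V → ℝ)).symm

theorem inner_degreeScaling [Nontrivial V] (hG : G.Connected) (f g : V → ℝ) :
    ⟪degreeScaling hG f, degreeScaling hG g⟫_ℝ = ∑ u, G.degree u * (f u * g u) := by
  rw [PiLp.inner_apply]
  refine Finset.sum_congr rfl fun u _ => ?_
  change √(G.degree u : ℝ) * g u * (√(G.degree u : ℝ) * f u) = _
  linear_combination (f u * g u) * Real.mul_self_sqrt (Nat.cast_nonneg (α := ℝ) (G.degree u))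

theorem norm_degreeScaling_sq [Nontrivial V] (hG : G.Connected) (f : V → ℝ) :
    ‖degreeScaling hG f‖ ^ 2 = ∑ u, G.degree u * f u ^ 2 := by
  rw [← real_inner_self_eq_norm_sq, inner_degreeScaling]
  simp only [sq]

variable [DecidableEq V]

theorem degree_mul_transition_mulVec (f : V → ℝ) (u : V) :
    G.degree u * (transition G *ᵥ f) u = G.degree u * f u - (G.lapMatrix ℝ *ᵥ f) u / 2 := by
  have hentry : ∀ v, G.degree u * transition G u v =
      (if v = u then (G.degree u : ℝ) / 2 else 0) + if G.Adj u v then 1 / 2 else 0 := fun v => by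
    rcases eq_or_ne v u with rfl | hvu
    · simp [transition, div_eq_mul_inv]
    · by_cases huv : G.Adj u v
      · have hu : (G.degree u : ℝ) ≠ 0 :=
          Nat.cast_ne_zero.2 ((G.degree_pos_iff_exists_adj u).2 ⟨v, huv⟩).ne'
        simp only [transition, of_apply, hvu, huv, if_true, if_false]
        field_simp
        ring
      · simp [transition, hvu, huv]
  rw [G.lapMatrix_mulVec_apply, G.neighborFinset_eq_filter, Finset.sum_filter, mulVec, dotProduct,
    Finset.mul_sum]
  simp only [← mul_assoc, hentry, add_mul, Finset.sum_add_distrib, ite_mul, zero_mul,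
    Finset.sum_ite_eq', Finset.mem_univ, if_true]
  have : ∑ v, (if G.Adj u v then 1 / 2 * f v else 0) = (∑ v, if G.Adj u v then f v else 0) / 2 := by
    rw [Finset.sum_div]
    exact Finset.sum_congr rfl fun v _ => by split_ifs <;> ring
  rw [this]
  ring

theorem sum_degree_mul_mul_transition_mulVec (f g : V → ℝ) :
    ∑ u, G.degree u * (f u * (transition G *ᵥ g) u) =
      ∑ u, G.degree u * (f u * g u) - dirichletForm G f g / 2 := by
  rw [dirichletForm, dotProduct, Finset.sum_div, ← Finset.sum_sub_distrib]
  refine Finset.sum_congr rfl fun u _ => ?_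
  rw [mul_left_comm, degree_mul_transition_mulVec]
  ring

variable [Nontrivial V]

/-- The transition operator transported to Euclidean space by `degreeScaling`, where it becomes
symmetric; its matrix is `D^{1/2} P D^{-1/2}`. -/
noncomputable def symmTransition (hG : G.Connected) :
    EuclideanSpace ℝ V →ₗ[ℝ] EuclideanSpace ℝ V :=
  (degreeScaling hG).conj (toLin' (transition G))

theorem symmTransition_degreeScaling (hG : G.Connected) (f : V → ℝ) :
    symmTransition hG (degreeScaling hG f) = degreeScaling hG (transition G *ᵥ f) := by
  simp [symmTransition, LinearEquiv.conj_apply_apply]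

theorem inner_degreeScaling_symmTransition (hG : G.Connected) (f g : V → ℝ) :
    ⟪degreeScaling hG f, symmTransition hG (degreeScaling hG g)⟫_ℝ =
      ∑ u, G.degree u * (f u * g u) - dirichletForm G f g / 2 := by
  rw [symmTransition_degreeScaling, inner_degreeScaling, sum_degree_mul_mul_transition_mulVec]

theorem isSymmetric_symmTransition (hG : G.Connected) : (symmTransition hG).IsSymmetric := by
  intro a b
  obtain ⟨f, rfl⟩ := (degreeScaling hG).surjective a
  obtain ⟨g, rfl⟩ := (degreeScaling hG).surjective b
  rw [real_inner_comm, inner_degreeScaling_symmTransition, inner_degreeScaling_symmTransition,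
    dirichletForm_comm]
  simp only [mul_comm]

theorem inner_symmTransition_self_le (hG : G.Connected) (a : EuclideanSpace ℝ V) :
    ⟪symmTransition hG a, a⟫_ℝ ≤ 1 * ‖a‖ ^ 2 := by
  obtain ⟨f, rfl⟩ := (degreeScaling hG).surjective a
  rw [real_inner_comm, inner_degreeScaling_symmTransition, ← inner_degreeScaling hG,
    real_inner_self_eq_norm_sq]
  linarith [dirichletForm_self_nonneg (G := G) f]

theorem symmTransition_degreeScaling_one (hG : G.Connected) :
    symmTransition hG (degreeScaling hG 1) = (1 : ℝ) • degreeScaling hG 1 := by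
  have hfix : transition G *ᵥ 1 = 1 := by
    ext u
    have hu := degree_mul_transition_mulVec (G := G) 1 u
    rw [show G.lapMatrix ℝ *ᵥ 1 = 0 from G.lapMatrix_mulVec_const_eq_zero] at hu
    exact mul_left_cancel₀ (degree_pos_of_connected hG u).ne' (by simpa using hu)
  rw [symmTransition_degreeScaling, hfix, one_smul]

theorem secondEigenvalue_eq (hG : G.Connected) :
    secondEigenvalue G = (isSymmetric_symmTransition hG).eigenvalues finrank_euclideanSpace
      ⟨1, Fintype.one_lt_card⟩ := by
  have hsort := (isSymmetric_symmTransition hG).sort_roots_charpoly_eq_eigenvalues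
    finrank_euclideanSpace
  simp only [symmTransition, LinearEquiv.charpoly_conj, charpoly_toLin', RCLike.re_to_real,
    Multiset.map_id'] at hsort
  have hcard : 1 < Fintype.card V := Fintype.one_lt_card
  rw [secondEigenvalue, eigenvalueList, hsort, List.getD_eq_getElem _ _ (by simpa using hcard),
    List.getElem_ofFn]
  rfl

theorem exists_dirichletForm_self_eq_mul (hG : G.Connected) :
    ∃ f : V → ℝ, f ≠ 0 ∧ ∑ u, G.degree u * f u = 0 ∧
      dirichletForm G f f = 2 * (1 - secondEigenvalue G) * ∑ u, G.degree u * f u ^ 2 := by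
  obtain ⟨a, ha, horth, heig⟩ := exists_second_eigenvector_orthogonal
    (isSymmetric_symmTransition hG) finrank_euclideanSpace Fintype.one_lt_card
    (symmTransition_degreeScaling_one hG) (inner_symmTransition_self_le hG)
  obtain ⟨f, rfl⟩ := (degreeScaling hG).surjective a
  refine ⟨f, fun hf => ha (by rw [hf, map_zero]), by simpa [inner_degreeScaling] using horth, ?_⟩
  have hquad := inner_degreeScaling_symmTransition hG f f
  rw [heig, ← secondEigenvalue_eq, inner_smul_right, inner_degreeScaling] at hquad
  simp only [RCLike.ofReal_real_eq_id, id_eq, ← sq] at hquad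
  linarith

theorem one_sub_secondEigenvalue_mul_le_dirichletForm (hG : G.Connected) {f : V → ℝ}
    (hf : ∑ u, G.degree u * f u = 0) :
    2 * (1 - secondEigenvalue G) * ∑ u, G.degree u * f u ^ 2 ≤ dirichletForm G f f := by
  have hone : degreeScaling hG 1 ≠ 0 := by simp
  have hle := re_inner_map_self_le_second_eigenvalue (isSymmetric_symmTransition hG)
    finrank_euclideanSpace Fintype.one_lt_card hone (symmTransition_degreeScaling_one hG)
    (inner_symmTransition_self_le hG) (g := degreeScaling hG f)
    (by simpa [inner_degreeScaling] using hf)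
  rw [RCLike.re_to_real, real_inner_comm, inner_degreeScaling_symmTransition,
    ← secondEigenvalue_eq, norm_degreeScaling_sq] at hle
  simp only [← sq] at hle
  linarith

end LazyWalkSpectrum

section RelaxationTime

variable {V : Type*} [Fintype V] [Nontrivial V] {G : SimpleGraph V} [DecidableRel G.Adj]

theorem sum_degree_mul_sq_pos (hG : G.Connected) {f : V → ℝ} (hf : f ≠ 0) :
    0 < ∑ u, G.degree u * f u ^ 2 := by
  obtain ⟨u, hu⟩ := Function.ne_iff.1 hf
  exact Finset.sum_pos' (fun v _ => by positivity)
    ⟨u, Finset.mem_univ u, mul_pos (degree_pos_of_connected hG u) (sq_pos_of_ne_zero hu)⟩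

theorem sum_degree_pos (hG : G.Connected) : 0 < ∑ u, (G.degree u : ℝ) :=
  Finset.sum_pos (fun u _ => degree_pos_of_connected hG u) Finset.univ_nonempty

variable [DecidableEq V]

theorem secondEigenvalue_lt_one (hG : G.Connected) : secondEigenvalue G < 1 := by
  obtain ⟨f, hf, hmean, hE⟩ := exists_dirichletForm_self_eq_mul hG
  by_contra! hle
  have hconst : ∀ u v, f u = f v := by
    refine eq_of_dirichletForm_self_eq_zero hG ((dirichletForm_self_nonneg f).antisymm' ?_)
    rw [hE]
    nlinarith [sum_degree_mul_sq_pos hG hf]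
  refine hf (funext fun u => ?_)
  simp only [fun v => hconst v u, ← Finset.sum_mul] at hmean
  exact (mul_eq_zero.1 hmean).resolve_left (sum_degree_pos hG).ne'

theorem one_le_relaxationTime (hG : G.Connected) : 1 ≤ relaxationTime G := by
  obtain ⟨f, hf, -, hE⟩ := exists_dirichletForm_self_eq_mul hG
  have hpos := sum_degree_mul_sq_pos hG hf
  have hgap : 1 - secondEigenvalue G ≤ 1 := by
    have := hE ▸ dirichletForm_self_le (G := G) f
    nlinarith
  exact (one_le_inv₀ (sub_pos.2 (secondEigenvalue_lt_one hG))).2 hgap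

theorem poincare_of_sum_eq_zero (hG : G.Connected) {f : V → ℝ}
    (hf : ∑ u, G.degree u * f u = 0) :
    2 * ∑ u, G.degree u * f u ^ 2 ≤ relaxationTime G * dirichletForm G f f := by
  rw [relaxationTime, ← div_eq_inv_mul, le_div_iff₀ (sub_pos.2 (secondEigenvalue_lt_one hG))]
  linarith [one_sub_secondEigenvalue_mul_le_dirichletForm hG hf]

end RelaxationTime

section Volume

open Finset

variable {V : Type*} [Fintype V] (G : SimpleGraph V) [DecidableRel G.Adj]

/-- The volume of a set of vertices: the sum of their degrees. -/
def volume (A : Finset V) : ℕ :=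
  ∑ u ∈ A, G.degree u

variable {G} {A B : Finset V} {f : V → ℝ}

theorem card_mul_minDegree_le_volume : #A * G.minDegree ≤ volume G A :=
  card_nsmul_le_sum _ _ _ fun u _ => G.minDegree_le_degree u

theorem volume_mono (h : A ⊆ B) : volume G A ≤ volume G B :=
  sum_le_sum_of_subset h

theorem two_mul_volume_le_or_of_disjoint (h : Disjoint A B) :
    2 * volume G A ≤ volume G univ ∨ 2 * volume G B ≤ volume G univ := by
  classical
  have hsum : volume G A + volume G B ≤ volume G univ := by
    rw [volume, volume, ← sum_union h]
    exact volume_mono (subset_univ _)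
  omega

theorem volume_mul_sq_le {h : ℝ} (hh : 0 ≤ h) (hA : ∀ u ∈ A, h ≤ f u) :
    volume G A * h ^ 2 ≤ ∑ u, G.degree u * f u ^ 2 := by
  rw [volume, Nat.cast_sum, sum_mul]
  calc ∑ u ∈ A, G.degree u * h ^ 2
      ≤ ∑ u ∈ A, G.degree u * f u ^ 2 := by
        gcongr with u hu
        exact hA u hu
    _ ≤ ∑ u, G.degree u * f u ^ 2 :=
        sum_le_univ_sum_of_nonneg fun u => by positivity

theorem sq_sum_degree_mul_le_volume_mul (hf : ∀ u ∉ A, f u = 0) :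
    (∑ u, G.degree u * f u) ^ 2 ≤ volume G A * ∑ u, G.degree u * f u ^ 2 := by
  have hsupp : ∀ g : V → ℝ, (∀ u ∉ A, g u = 0) →
      ∑ u, G.degree u * g u = ∑ u ∈ A, G.degree u * g u := fun g hg =>
    (sum_subset (subset_univ A) fun u _ hu => by rw [hg u hu, mul_zero]).symm
  rw [hsupp f hf, hsupp _ fun u hu => by rw [hf u hu, zero_pow two_ne_zero], volume, Nat.cast_sum]
  exact sum_sq_le_sum_mul_sum_of_sq_le_mul A (fun u _ => by positivity)
    (fun u _ => by positivity) fun u _ => le_of_eq (by ring)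

/-- Since `f` lives on half of the volume, subtracting its mean at most halves `∑ d f²`. -/
theorem poincare_of_volume_le [DecidableEq V] [Nontrivial V] (hG : G.Connected)
    (hA : 2 * volume G A ≤ volume G univ) (hf : ∀ u ∉ A, f u = 0) :
    ∑ u, G.degree u * f u ^ 2 ≤ relaxationTime G * dirichletForm G f f := by
  set D : ℝ := ∑ u, (G.degree u : ℝ) with hD
  set M := ∑ u, G.degree u * f u with hM
  set S := ∑ u, G.degree u * f u ^ 2 with hS
  have hDpos : 0 < D := sum_degree_pos hG
  have hmean : ∑ u, G.degree u * (f u - M / D) = 0 := by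
    simp only [mul_sub, sum_sub_distrib, ← sum_mul]
    rw [← hM, ← hD, mul_div_cancel₀ _ hDpos.ne', sub_self]
  have hvar : ∑ u, G.degree u * (f u - M / D) ^ 2 = S - M ^ 2 / D := by
    have hexpand : ∀ u, G.degree u * (f u - M / D) ^ 2 =
        G.degree u * f u ^ 2 - 2 * (M / D) * (G.degree u * f u) + G.degree u * (M / D) ^ 2 :=
      fun u => by ring
    simp only [hexpand, sum_add_distrib, sum_sub_distrib, ← mul_sum, ← sum_mul]
    rw [← hM, ← hD, ← hS]
    field_simp
    ring
  have hM2 : M ^ 2 / D ≤ S / 2 := by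
    have hAD : 2 * (volume G A : ℝ) ≤ D := by
      rw [hD, ← Nat.cast_sum]
      exact_mod_cast hA
    have hS0 : 0 ≤ S := sum_nonneg fun u _ => by positivity
    rw [div_le_iff₀ hDpos]
    linarith [sq_sum_degree_mul_le_volume_mul (G := G) hf, mul_le_mul_of_nonneg_right hAD hS0]
  have hpoincare := poincare_of_sum_eq_zero hG hmean
  rw [dirichletForm_sub_const_self, hvar] at hpoincare
  linarith

end Volume

section Distance

open Finset

variable {V : Type*} {G : SimpleGraph V} {x y : V}

theorem exists_dist_eq {k : ℕ} (hk : k ≤ G.dist x y) : ∃ v, G.dist x v = k := by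
  rcases k.eq_zero_or_pos with rfl | hpos
  · exact ⟨x, SimpleGraph.dist_self⟩
  obtain ⟨p, hp⟩ := SimpleGraph.exists_walk_of_dist_ne_zero (hpos.trans_le hk).ne'
  refine ⟨p.getVert k, ?_⟩
  rw [← SimpleGraph.length_eq_dist_of_subwalk hp (p.isSubwalk_take k),
    SimpleGraph.Walk.take_length, min_eq_left (hp ▸ hk)]

/-- The neighbourhoods of points at distances `0, 3, …, 3 * j` from `x` are disjoint. -/
theorem mul_minDegree_le_card_dist_le [Fintype V] [DecidableRel G.Adj] (j : ℕ)
    (hj : 3 * j ≤ G.dist x y) :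
    (j + 1) * G.minDegree ≤ #{u | G.dist x u ≤ 3 * j + 1} := by
  classical
  induction j with
  | zero =>
    rw [zero_add, one_mul]
    refine (G.minDegree_le_degree x).trans (card_le_card fun u hu => ?_)
    rw [mem_filter_univ, SimpleGraph.dist_eq_one_iff_adj.2 ((G.mem_neighborFinset x u).1 hu)]
  | succ j ih =>
    obtain ⟨v, hv⟩ := exists_dist_eq hj
    have hdist : ∀ u ∈ G.neighborFinset v, 3 * j + 2 ≤ G.dist x u ∧ G.dist x u ≤ 3 * j + 4 :=
      fun u hu => by
        have := ((G.mem_neighborFinset v u).1 hu).diff_dist_adj (u := x)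
        omega
    have hdisj : Disjoint ({u | G.dist x u ≤ 3 * j + 1} : Finset V) (G.neighborFinset v) :=
      disjoint_left.2 fun u hu huv => by
        have := (hdist u huv).1
        rw [mem_filter_univ] at hu
        omega
    calc (j + 1 + 1) * G.minDegree
        = (j + 1) * G.minDegree + G.minDegree := Nat.succ_mul ..
      _ ≤ #{u | G.dist x u ≤ 3 * j + 1} + #(G.neighborFinset v) :=
        add_le_add (ih (by omega)) (G.minDegree_le_degree v)
      _ = #(({u | G.dist x u ≤ 3 * j + 1} : Finset V) ∪ G.neighborFinset v) :=
        (card_union_of_disjoint hdisj).symm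
      _ ≤ #{u | G.dist x u ≤ 3 * (j + 1) + 1} := card_le_card fun u hu => by
        rw [mem_union, mem_filter_univ] at hu
        rw [mem_filter_univ]
        rcases hu with hu | hu
        · omega
        · have := (hdist u hu).2
          omega

end Distance

namespace IsUnitCurrentVoltage

open Finset Matrix

variable {V : Type*} [Fintype V] [DecidableEq V] {G : SimpleGraph V} [DecidableRel G.Adj]
  {x y u v : V} {W : V → ℝ}

theorem neg (hW : IsUnitCurrentVoltage G x y W) : IsUnitCurrentVoltage G y x (-W) := by
  rw [isUnitCurrentVoltage_iff] at hW ⊢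
  rw [mulVec_neg, hW, neg_sub]

theorem dirichletForm_eq (hW : IsUnitCurrentVoltage G x y W) (f : V → ℝ) :
    dirichletForm G f W = f x - f y := by
  rw [dirichletForm, isUnitCurrentVoltage_iff.1 hW, dotProduct_sub, dotProduct_single_one,
    dotProduct_single_one]

theorem dirichletForm_posPart_sub_le (hW : IsUnitCurrentVoltage G x y W) (m : ℝ) :
    dirichletForm G (fun u => (W u - m)⁺) (fun u => (W u - m)⁺) ≤ (W x - m)⁺ - (W y - m)⁺ := by
  rw [← hW.dirichletForm_eq fun u => (W u - m)⁺, ← dirichletForm_sub_const_right _ W m]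
  exact dirichletForm_posPart_self_le fun u => W u - m

theorem le_source (hW : IsUnitCurrentVoltage G x y W) (hG : G.Connected) (u : V) :
    W u ≤ W x := by
  have hE := hW.dirichletForm_posPart_sub_le (W x)
  rw [sub_self, posPart_zero] at hE
  have hE₀ := (dirichletForm_self_nonneg fun u => (W u - W x)⁺).antisymm'
    (hE.trans (by simp [posPart_nonneg]))
  have hux := eq_of_dirichletForm_self_eq_zero hG hE₀ u x
  rw [sub_self, posPart_zero, posPart_eq_zero] at hux
  exact sub_nonpos.1 hux

/-- The net current through the cut `{w | W w > W v}` is at most `1`, and every edge of the cut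
carries its current in the same direction. -/
theorem sub_le_one (hW : IsUnitCurrentVoltage G x y W) (huv : G.Adj u v) : W u - W v ≤ 1 := by
  rcases le_or_gt (W u) (W v) with hle | hlt
  · linarith
  set φ : V → ℝ := fun w => if W v < W w then 1 else 0 with hφ
  have hmono : Monovary φ W := fun a b hab => by
    simp only [hφ]
    split_ifs with ha hb
    exacts [le_rfl, absurd (ha.trans hab) hb, zero_le_one, le_rfl]
  have hφ01 : ∀ w, 0 ≤ φ w ∧ φ w ≤ 1 := fun w => by
    simp only [hφ]
    split_ifs <;> norm_num
  have hcut := mul_sub_le_dirichletForm hmono huv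
  rw [hW.dirichletForm_eq, show φ u = 1 from if_pos hlt, show φ v = 0 from if_neg (lt_irrefl _),
    sub_zero, one_mul] at hcut
  linarith [(hφ01 x).2, (hφ01 y).1]

theorem sub_le_dist (hW : IsUnitCurrentVoltage G x y W) (huv : G.Reachable u v) :
    W u - W v ≤ G.dist u v := by
  obtain ⟨p, hp⟩ := huv.exists_walk_length_eq_dist
  rw [← hp]
  clear hp huv
  induction p with
  | nil => simp
  | cons h p ih =>
    rw [SimpleGraph.Walk.length_cons, Nat.cast_succ]
    linarith [hW.sub_le_one h]

theorem card_filter_lt_mul_le_one (hW : IsUnitCurrentVoltage G x y W) (hG : G.Connected) (r : ℝ) :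
    #{v ∈ G.neighborFinset x | W v < W x - r} * r ≤ 1 := by
  calc #{v ∈ G.neighborFinset x | W v < W x - r} * r
      ≤ ∑ v ∈ G.neighborFinset x with W v < W x - r, (W x - W v) := by
        rw [← nsmul_eq_mul]
        refine card_nsmul_le_sum _ _ _ fun v hv => ?_
        linarith [(mem_filter.1 hv).2]
    _ ≤ ∑ v ∈ G.neighborFinset x, (W x - W v) :=
        sum_le_sum_of_subset_of_nonneg (filter_subset _ _) fun v _ _ =>
          sub_nonneg.2 (hW.le_source hG v)
    _ ≤ 1 := by
        rw [hW x, if_pos rfl]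
        split_ifs <;> norm_num

theorem sq_minDegree_le_volume_superlevel (hW : IsUnitCurrentVoltage G x y W) (hG : G.Connected)
    {r : ℝ} (hr : 2 ≤ r * G.minDegree) :
    (G.minDegree : ℝ) ^ 2 / 2 ≤ volume G {u | W x - r ≤ W u} := by
  set near := {v ∈ G.neighborFinset x | W x - r ≤ W v} with hnear
  set far := {v ∈ G.neighborFinset x | W v < W x - r} with hfar
  have hsplit : (#near : ℝ) + #far = G.degree x := by
    rw [← G.card_neighborFinset_eq_degree, hnear, hfar]
    simp only [← not_le]
    exact_mod_cast card_filter_add_card_filter_not _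
  have hfew : 2 * (#far : ℝ) ≤ G.minDegree :=
    calc 2 * (#far : ℝ) ≤ r * G.minDegree * #far := by gcongr
      _ = #far * r * G.minDegree := by ring
      _ ≤ 1 * G.minDegree := by
        gcongr
        exact hW.card_filter_lt_mul_le_one hG r
      _ = G.minDegree := one_mul _
  have hmany : (G.minDegree : ℝ) / 2 ≤ #near := by
    have : (G.minDegree : ℝ) ≤ G.degree x := Nat.cast_le.2 (G.minDegree_le_degree x)
    linarith
  calc (G.minDegree : ℝ) ^ 2 / 2 = G.minDegree / 2 * G.minDegree := by ring
    _ ≤ #near * G.minDegree := by gcongr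
    _ ≤ volume G near := by exact_mod_cast card_mul_minDegree_le_volume
    _ ≤ volume G {u | W x - r ≤ W u} := by
      exact_mod_cast volume_mono (filter_subset_filter _ (subset_univ _))

theorem mul_sq_minDegree_le_volume_superlevel_of_one_le (hW : IsUnitCurrentVoltage G x y W)
    (hG : G.Connected) {r : ℝ} (hr : 1 ≤ r) (hdrop : r ≤ W x - W y) :
    r * G.minDegree ^ 2 / 4 ≤ volume G {u | W x - r ≤ W u} := by
  set j := ⌊(r - 1) / 3⌋₊
  have hj : 3 * (j : ℝ) + 1 ≤ r := by
    have := Nat.floor_le (a := (r - 1) / 3) (by linarith)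
    linarith
  have hj' : r ≤ 4 * (j + 1) := by
    have := Nat.lt_floor_add_one ((r - 1) / 3)
    linarith [(Nat.cast_nonneg j : (0 : ℝ) ≤ j)]
  have hfar : 3 * j ≤ G.dist x y := by
    have : (3 * j : ℝ) ≤ G.dist x y := by linarith [hW.sub_le_dist (hG.preconnected x y)]
    exact_mod_cast this
  have hball : ({u | G.dist x u ≤ 3 * j + 1} : Finset V) ⊆
      ({u | W x - r ≤ W u} : Finset V) := fun u hu => by
    rw [mem_filter_univ] at hu ⊢
    have : (G.dist x u : ℝ) ≤ 3 * j + 1 := by exact_mod_cast hu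
    linarith [hW.sub_le_dist (hG.preconnected x u)]
  calc r * (G.minDegree : ℝ) ^ 2 / 4 ≤ 4 * (j + 1) * (G.minDegree : ℝ) ^ 2 / 4 := by gcongr
    _ = ((j + 1) * G.minDegree : ℕ) * (G.minDegree : ℝ) := by push_cast; ring
    _ ≤ (#{u | W x - r ≤ W u} : ℝ) * G.minDegree := by
      gcongr
      exact (mul_minDegree_le_card_dist_le j hfar).trans (card_le_card hball)
    _ ≤ (volume G {u | W x - r ≤ W u} : ℝ) := by exact_mod_cast card_mul_minDegree_le_volume

theorem mul_sq_minDegree_le_volume_superlevel (hW : IsUnitCurrentVoltage G x y W)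
    (hG : G.Connected) {r : ℝ} (hr : 2 ≤ r * G.minDegree) (hdrop : r ≤ W x - W y) :
    r * G.minDegree ^ 2 / 4 ≤ volume G {u | W x - r ≤ W u} := by
  rcases le_total r 1 with hr1 | hr1
  · refine le_trans ?_ (hW.sq_minDegree_le_volume_superlevel hG hr)
    nlinarith [sq_nonneg (G.minDegree : ℝ)]
  · exact hW.mul_sq_minDegree_le_volume_superlevel_of_one_le hG hr1 hdrop

theorem volume_superlevel_mul_le [Nontrivial V] (hW : IsUnitCurrentVoltage G x y W)
    (hG : G.Connected) {m r : ℝ} (hvol : 2 * volume G {u | m < W u} ≤ volume G univ)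
    (hr : 0 ≤ r) (hrm : r ≤ W x - m) :
    volume G {u | W x - r ≤ W u} * (W x - m - r) ^ 2 ≤ relaxationTime G * (W x - m) := by
  have hE : dirichletForm G (fun u => (W u - m)⁺) (fun u => (W u - m)⁺) ≤ W x - m :=
    calc _ ≤ (W x - m)⁺ - (W y - m)⁺ := hW.dirichletForm_posPart_sub_le m
      _ ≤ (W x - m)⁺ := sub_le_self _ (posPart_nonneg _)
      _ = W x - m := posPart_of_nonneg (hr.trans hrm)
  calc volume G {u | W x - r ≤ W u} * (W x - m - r) ^ 2
      ≤ ∑ u, G.degree u * (W u - m)⁺ ^ 2 := by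
        refine volume_mul_sq_le (by linarith) fun u hu => ?_
        rw [mem_filter_univ] at hu
        exact le_trans (by linarith) (le_posPart _)
    _ ≤ relaxationTime G * dirichletForm G (fun u => (W u - m)⁺) (fun u => (W u - m)⁺) :=
        poincare_of_volume_le hG hvol fun u hu => by
          rw [mem_filter_univ, not_lt] at hu
          exact posPart_of_nonpos (sub_nonpos.2 hu)
    _ ≤ relaxationTime G * (W x - m) := by
        gcongr
        exact zero_le_one.trans (one_le_relaxationTime hG)

theorem sub_mul_minDegree_le [Nontrivial V] (hW : IsUnitCurrentVoltage G x y W)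
    (hG : G.Connected) {m : ℝ} (hym : W y ≤ m)
    (hvol : 2 * volume G {u | m < W u} ≤ volume G univ) :
    (W x - m) * G.minDegree ≤ 6 * √(relaxationTime G) := by
  have ht := one_le_relaxationTime hG
  set r := (W x - m) / 2 with hr
  rcases lt_or_ge (r * G.minDegree) 2 with hsmall | hlarge
  · have := Real.one_le_sqrt.2 ht
    have : (W x - m) * G.minDegree = 2 * (r * G.minDegree) := by ring
    linarith
  have hr0 : 0 < r := pos_of_mul_pos_left (two_pos.trans_le hlarge) (Nat.cast_nonneg _)
  have hupper : volume G {u | W x - r ≤ W u} * r ≤ 2 * relaxationTime G := by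
    have := hW.volume_superlevel_mul_le hG hvol hr0.le (by linarith)
    have hm : W x - m = 2 * r := by linarith
    rw [hm, show 2 * r - r = r by ring] at this
    exact le_of_mul_le_mul_right (by linarith) hr0
  have hlower := hW.mul_sq_minDegree_le_volume_superlevel hG hlarge (by linarith)
  have hsq : (r * G.minDegree) ^ 2 ≤ 8 * relaxationTime G := by
    linarith [mul_le_mul_of_nonneg_right hlower hr0.le]
  have hsqrt := Real.sq_sqrt (zero_le_one.trans ht)
  have hroot : r * G.minDegree ≤ 3 * √(relaxationTime G) := by
    refine abs_le_of_sq_le_sq' ?_ (by positivity) |>.2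
    rw [mul_pow 3, hsqrt]
    linarith
  linarith [show (W x - m) * G.minDegree = 2 * (r * G.minDegree) by ring]

end IsUnitCurrentVoltage

theorem effectiveResistance_le {V : Type*} [Fintype V] [DecidableEq V] [Nontrivial V]
    {G : SimpleGraph V} [DecidableRel G.Adj] (hG : G.Connected) (x y : V) :
    effectiveResistance hG x y ≤ 12 * √(relaxationTime G) / G.minDegree := by
  obtain ⟨W, hW⟩ := exists_isUnitCurrentVoltage hG x y
  have hδ : (0 : ℝ) < G.minDegree := Nat.cast_pos.2 hG.preconnected.minDegree_pos_of_nontrivial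
  have hyx : W y ≤ W x := hW.le_source hG y
  set m := (W x + W y) / 2 with hm
  have hdisj : Disjoint ({u | m < W u} : Finset V) ({u | -m < (-W) u} : Finset V) :=
    Finset.disjoint_filter.2 fun u _ hu => not_lt.2 (neg_le_neg hu.le)
  have hhalf : (W x - W y) / 2 * G.minDegree ≤ 6 * √(relaxationTime G) := by
    rcases two_mul_volume_le_or_of_disjoint (G := G) hdisj with hvol | hvol
    · convert hW.sub_mul_minDegree_le hG (by linarith) hvol using 2
      linarith
    · convert hW.neg.sub_mul_minDegree_le hG (neg_le_neg (by linarith)) hvol using 2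
      simp only [Pi.neg_apply]
      linarith
  rw [effectiveResistance_eq hG hW, le_div_iff₀ hδ]
  linarith

end LazyWalk

theorem mainTheorem5 :
    ∃ K : ℝ, 0 < K ∧
      ∀ (V : Type*) [Fintype V] [DecidableEq V] [Nontrivial V]
        (G : SimpleGraph V) [DecidableRel G.Adj] (hG : G.Connected) (x y : V),
        LazyWalk.effectiveResistance hG x y ≤
          K * Real.sqrt (LazyWalk.relaxationTime G) / (G.minDegree : ℝ) :=
  ⟨12, by norm_num, fun _ _ _ _ _ _ hG x y => LazyWalk.effectiveResistance_le hG x y⟩
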